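/- Let $X=\mathbb P^1$ be the real projective line: the space of lines through the origin in $\mathbb R^2$, with the quotient topology. A Möbius transformation of $X$ is the homeomorphism $\ell\mapsto g\ell$ induced by a matrix $g\in GL(2,\mathbb R)$. It is called parabolic if $g$ is non-scalar with a double eigenvalue (equivalently, it has exactly one fixed point in $X$), and it is called an irrational rotation if it is induced by a matrix of the form $P\begin{pmatrix}\cos\theta&-\sin\theta\\ \sin\theta&\cos\theta\end{pmatrix}P^{-1}$ with $P\in GL(2,\mathbb R)$ and $\theta/\pi$ irrational. Such transformations exist. Moreover, for every parabolic Möbius transformation $T$ and every irrational rotation $R$ of $X$, let $G=\langle T,R\rangle$ be the subgroup of $\mathrm{Homeo}(X)$ that they generate. Let $E(X)$ be the enveloping semigroup of $(G,X)$, that is, the closure of $\{x\mapsto gx : g\in G\}$ in $X^X$ with the product topology, and let $P(X)$ be the space of Borel probability measures on $X$ with the topology of weak convergence, on which $G$ acts by push-forward. Then: 1. $X$ is compact and metrizable, and $(G,X)$ is minimal (every $G$-orbit is dense). 2. Every $p\in E(X)$ is of Baire class 1: the preimage $p^{-1}(U)$ of every open set $U\subseteq X$ is an $F_\sigma$ set.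 3. $(G,X)$ is tame: every $p\in E(X)$ is fragmented, i.e. for every nonempty $A\subseteq X$ and every entourage $\varepsilon$ of the unique compatible uniformity of $X$ there is an open $O\subseteq X$ such that $O\cap A\neq\emptyset$ and $(p(x),p(y))\in\varepsilon$ for all $x,y\in O\cap A$. 4. $(G,X)$ is strongly proximal: for all $\mu,\nu\in P(X)$ there are a net $(g_i)$ in $G$ and $\lambda\in P(X)$ with $\lim g_i\mu=\lambda=\lim g_i\nu$. 5. $P(X)$ has no $G$-fixed point; equivalently, $X$ has no $G$-invariant Borel probability measure. In particular, there exists a tame minimal compact metric $G$-system without an invariant probability measure. -/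

import Mathlib

open scoped LinearAlgebra.Projectivization
open MeasureTheory

section Dynamics

/-- The group of self-homeomorphisms of `X` acts on `X` by evaluation. -/
instance homeoMulAction {X : Type*} [TopologicalSpace X] : MulAction (X ≃ₜ X) X where
  smul g x := g x
  one_smul _ := rfl
  mul_smul _ _ _ := rfl

instance homeoContinuousConstSMul {X : Type*} [TopologicalSpace X] :
    ContinuousConstSMul (X ≃ₜ X) X where
  continuous_const_smul g := g.continuous

instance subgroupContinuousConstSMul {X : Type*} [TopologicalSpace X] (G : Subgroup (X ≃ₜ X)) :
    ContinuousConstSMul G X where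
  continuous_const_smul g := g.1.continuous

/-- A map `f : X → Y` from a topological space to a uniform space `(Y, ξ)` is fragmented if for
every nonempty `A ⊆ X` and every entourage `ε` there is an open `O ⊆ X` meeting `A` such that
`f (O ∩ A)` is `ε`-small. -/
def IsFragmented {X Y : Type*} [TopologicalSpace X] (ξ : UniformSpace Y) (f : X → Y) : Prop :=
  ∀ A : Set X, A.Nonempty → ∀ ε : Set (Y × Y), ε ∈ @uniformity Y ξ →
    ∃ O : Set X, IsOpen O ∧ (O ∩ A).Nonempty ∧ ∀ x ∈ O ∩ A, ∀ y ∈ O ∩ A, (f x, f y) ∈ ε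

/-- A map is of Baire class 1 if the preimage of every open set is an `F_σ` set. -/
def IsBaireClassOne {X Y : Type*} [TopologicalSpace X] [TopologicalSpace Y] (f : X → Y) : Prop :=
  ∀ U : Set Y, IsOpen U → ∃ F : ℕ → Set X, (∀ n, IsClosed (F n)) ∧ f ⁻¹' U = ⋃ n, F n

/-- The enveloping semigroup `E(X)` of a `G`-system `X`: the closure of the set of translations
in `X → X` with the topology of pointwise convergence. -/
def envelopingSemigroup (G X : Type*) [Group G] [TopologicalSpace X] [MulAction G X] :
    Set (X → X) :=
  closure (Set.range fun (g : G) (x : X) => g • x)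

/-- A compact `G`-system is tame if every element of its enveloping semigroup is fragmented
with respect to the unique compatible uniform structure. -/
def IsTame (G X : Type*) [Group G] [TopologicalSpace X] [CompactSpace X] [T2Space X]
    [MulAction G X] : Prop :=
  ∀ p ∈ envelopingSemigroup G X, IsFragmented uniformSpaceOfCompactR1 p

/-- A compact `G`-system is proximal if for any two points `x`, `y` there is a net `g i` in `G`
such that `g i • x` and `g i • y` converge to the same point `z`; that is, `(z, z)` lies in the
orbit closure of `(x, y)` under the diagonal action. -/
def IsProximalSystem (G X : Type*) [Group G] [TopologicalSpace X] [MulAction G X] : Prop :=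
  ∀ x y : X, ∃ z : X, (z, z) ∈ closure (MulAction.orbit G (x, y))

/-- The induced action on the space `P(X)` of Borel probability measures (which carries the
topology of weak convergence), by pushing measures forward. -/
noncomputable instance probabilityMeasureMulAction {G X : Type*} [Group G] [TopologicalSpace X]
    [MeasurableSpace X] [BorelSpace X] [MulAction G X] [ContinuousConstSMul G X] :
    MulAction G (ProbabilityMeasure X) where
  smul g μ := μ.map (continuous_const_smul g).measurable.aemeasurable
  one_smul μ := by
    apply Subtype.ext
    change Measure.map (fun x : X => (1 : G) • x) (μ : Measure X) = μ
    simp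
  mul_smul g h μ := by
    apply Subtype.ext
    change Measure.map (fun x : X => (g * h) • x) (μ : Measure X) =
      Measure.map (fun x : X => g • x) (Measure.map (fun x : X => h • x) (μ : Measure X))
    rw [Measure.map_map (continuous_const_smul g).measurable (continuous_const_smul h).measurable]
    congr 1
    funext x
    exact mul_smul g h x

/-- A compact `G`-system `X` is strongly proximal if the `G`-system `P(X)` is proximal. -/
def IsStronglyProximal (G X : Type*) [Group G] [TopologicalSpace X]
    [MeasurableSpace X] [BorelSpace X] [MulAction G X] [ContinuousConstSMul G X] : Prop :=
  IsProximalSystem G (ProbabilityMeasure X)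

end Dynamics

section ProjectiveLine

/-- The real projective line: all lines through the origin in the plane. -/
abbrev RP1 : Type := ℙ ℝ (Fin 2 → ℝ)

/-- The quotient topology from the nonzero vectors of the plane. -/
instance RP1.instTopologicalSpace : TopologicalSpace RP1 :=
  inferInstanceAs (TopologicalSpace (Quotient (projectivizationSetoid ℝ (Fin 2 → ℝ))))

instance RP1.instMeasurableSpace : MeasurableSpace RP1 := borel RP1

instance RP1.instBorelSpace : BorelSpace RP1 := ⟨rfl⟩

theorem RP1.isQuotientMap_mk :
    Topology.IsQuotientMap (Projectivization.mk' ℝ : { v : Fin 2 → ℝ // v ≠ 0 } → RP1) :=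
  isQuotientMap_quot_mk

instance RP1.instCompactSpace : CompactSpace RP1 := by
  let f : Metric.sphere (0 : Fin 2 → ℝ) 1 → RP1 := fun v =>
    Projectivization.mk' ℝ ⟨v, fun h => by simpa [h] using v.2⟩
  have hf : Continuous f :=
    RP1.isQuotientMap_mk.continuous.comp (continuous_subtype_val.subtype_mk _)
  have hs : Function.Surjective f := by
    intro x
    induction x using Projectivization.ind with | _ v hv =>
    have hn : ‖v‖ ≠ 0 := norm_ne_zero_iff.2 hv
    refine ⟨⟨‖v‖⁻¹ • v, by simp [norm_smul, hn]⟩, ?_⟩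
    exact (Projectivization.mk_eq_mk_iff' ℝ _ _ _ _).2 ⟨‖v‖⁻¹, rfl⟩
  exact hs.compactSpace hf

instance RP1.instT2Space : T2Space RP1 := by
  have pos : ∀ v : { v : Fin 2 → ℝ // v ≠ 0 }, v.1 0 ^ 2 + v.1 1 ^ 2 ≠ 0 := by
    rintro ⟨v, hv⟩ h
    apply hv
    ext i
    fin_cases i
    · simp only [Fin.zero_eta, Pi.zero_apply]; nlinarith [sq_nonneg (v 0), sq_nonneg (v 1)]
    · simp only [Fin.mk_one, Pi.zero_apply]; nlinarith [sq_nonneg (v 0), sq_nonneg (v 1)]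
  let f : { v : Fin 2 → ℝ // v ≠ 0 } → ℝ × ℝ × ℝ := fun v =>
    (v.1 0 ^ 2 / (v.1 0 ^ 2 + v.1 1 ^ 2), v.1 0 * v.1 1 / (v.1 0 ^ 2 + v.1 1 ^ 2),
      v.1 1 ^ 2 / (v.1 0 ^ 2 + v.1 1 ^ 2))
  have hf : Continuous f := by
    have h0 : Continuous fun v : { v : Fin 2 → ℝ // v ≠ 0 } => v.1 0 :=
      (continuous_apply 0).comp continuous_subtype_val
    have h1 : Continuous fun v : { v : Fin 2 → ℝ // v ≠ 0 } => v.1 1 :=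
      (continuous_apply 1).comp continuous_subtype_val
    have hd := (h0.pow 2).add (h1.pow 2)
    exact ((h0.pow 2).div hd pos).prodMk
      (((h0.mul h1).div hd pos).prodMk ((h1.pow 2).div hd pos))
  have hl : ∀ (a b : { v : Fin 2 → ℝ // v ≠ 0 }) (t : ℝ), a.1 = t • b.1 → f a = f b := by
    intro a b t h
    have ha := pos a
    have hb := pos b
    have h0 : a.1 0 = t * b.1 0 := by simp [h]
    have h1 : a.1 1 = t * b.1 1 := by simp [h]
    have ht : t ≠ 0 := by
      rintro rfl
      exact ha (by simp [h0, h1])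
    have hd : (t * b.1 0) ^ 2 + (t * b.1 1) ^ 2 = t ^ 2 * (b.1 0 ^ 2 + b.1 1 ^ 2) := by ring
    simp only [f, h0, h1, hd, Prod.mk.injEq]
    refine ⟨?_, ?_, ?_⟩ <;> field_simp
  refine T2Space.of_injective_continuous (f := Projectivization.lift f hl) ?_
    (RP1.isQuotientMap_mk.continuous_iff.2 hf)
  intro x y h
  induction x using Projectivization.ind with | _ v hv =>
  induction y using Projectivization.ind with | _ w hw =>
  have pv := pos ⟨v, hv⟩
  have pw := pos ⟨w, hw⟩
  simp only [Projectivization.lift_mk, f, Prod.mk.injEq] at h pv pw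
  obtain ⟨h1, h2, h3⟩ := h
  rw [div_eq_div_iff pv pw] at h1 h2 h3
  have key : v 0 * w 1 = v 1 * w 0 := by
    have : (w 0 ^ 2 + w 1 ^ 2) * (v 0 * w 1 - v 1 * w 0) ^ 2 = 0 := by
      linear_combination (w 1 ^ 2) * h1 - 2 * w 0 * w 1 * h2 + w 0 ^ 2 * h3
    have := (mul_eq_zero.1 this).resolve_left pw
    linarith [pow_eq_zero_iff (two_ne_zero) |>.1 this]
  refine (Projectivization.mk_eq_mk_iff' ℝ _ _ _ _).2
    ⟨(v 0 * w 0 + v 1 * w 1) / (w 0 ^ 2 + w 1 ^ 2), ?_⟩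
  ext i
  fin_cases i
  · simp only [Fin.zero_eta, Pi.smul_apply, smul_eq_mul]
    field_simp
    linear_combination - w 1 * key
  · simp only [Fin.mk_one, Pi.smul_apply, smul_eq_mul]
    field_simp
    linear_combination w 0 * key

instance RP1.instContinuousConstSMul : ContinuousConstSMul (GL (Fin 2) ℝ) RP1 where
  continuous_const_smul g := by
    refine RP1.isQuotientMap_mk.continuous_iff.2 ?_
    have : Continuous fun v : Fin 2 → ℝ => g • v :=
      (Matrix.mulVecLin g.1).continuous_of_finiteDimensional
    exact RP1.isQuotientMap_mk.continuous.comp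
      ((this.comp continuous_subtype_val).subtype_mk fun v => (smul_ne_zero_iff_ne g).2 v.2)

/-- The Möbius transformation of the projective line induced by an invertible matrix, sending the
line through `v` to the line through `g v`. -/
noncomputable def mobius (g : GL (Fin 2) ℝ) : RP1 ≃ₜ RP1 := Homeomorph.smul g

/-- A parabolic Möbius transformation: one induced by a non-scalar matrix with a double
eigenvalue, i.e. with exactly one fixed point on the projective line. -/
def IsParabolicMobius (T : RP1 ≃ₜ RP1) : Prop :=
  ∃ g : GL (Fin 2) ℝ, g.IsParabolic ∧ T = mobius g

/-- The matrix of the rotation of the plane by the angle `θ`. -/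
noncomputable def rotationMatrix (θ : ℝ) : GL (Fin 2) ℝ :=
  Matrix.planeConformalMatrix (Real.cos θ) (Real.sin θ) (by simp)

/-- A Möbius transformation which corresponds, up to a projective change of coordinates, to an
irrational rotation of the circle. The rotation of the plane by `θ` rotates the circle of lines,
which has total angle `π`, by the fraction `θ / π` of a full turn. -/
def IsIrrationalRotationMobius (R : RP1 ≃ₜ RP1) : Prop :=
  ∃ (P : GL (Fin 2) ℝ) (θ : ℝ), Irrational (θ / Real.pi) ∧
    R = mobius (P * rotationMatrix θ * P⁻¹)

end ProjectiveLine

open Filter Topology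

/-! ### Vectors and matrices of the plane -/

section Plane

/-! Two facts carry the proof. First, every element of `G` is a Möbius map, and a matrix matters
only up to scale, so it can be normalised to the unit sphere of matrices, which is compact. A
pointwise limit of Möbius maps is therefore governed by a nonzero limit matrix `A`. If `A` is
invertible, the limit is a Möbius map, hence continuous. If `A` has rank one, the limit is constant
off the kernel line (`continuous_or_isConstantOff_of_mem_closure`). Both kinds of map are of Baire
class 1 and fragmented.

Second, the powers of a parabolic element send every point to its fixed point `a`. By dominated
convergence they send every probability measure to the Dirac mass at `a`, which gives strong
proximality. An invariant measure would have to be that Dirac mass, so `a` would be fixed by `G`.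
The irrational rotation already has dense orbits, so `G` is minimal and this is impossible. -/

theorem cross_smul_eq (u v w : Fin 2 → ℝ) :
    (u 0 * w 1 - u 1 * w 0) • v =
      (v 0 * w 1 - v 1 * w 0) • u + (u 0 * v 1 - u 1 * v 0) • w := by
  ext i
  fin_cases i <;> simp <;> ring

/-- Cramer's rule with denominators cleared, so that no independence is needed. It is applied when
`A` kills one of the vectors, to compare the images of the other two. -/
theorem cross_smul_mulVec_eq (A : Matrix (Fin 2) (Fin 2) ℝ) (u v w : Fin 2 → ℝ) :
    (u 0 * w 1 - u 1 * w 0) • A.mulVec v =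
      (v 0 * w 1 - v 1 * w 0) • A.mulVec u + (u 0 * v 1 - u 1 * v 0) • A.mulVec w := by
  rw [← Matrix.mulVec_smul, cross_smul_eq, Matrix.mulVec_add, Matrix.mulVec_smul,
    Matrix.mulVec_smul]

theorem mulVec_cross_eq (A : Matrix (Fin 2) (Fin 2) ℝ) (v w : Fin 2 → ℝ) :
    A.mulVec v 0 * A.mulVec w 1 - A.mulVec v 1 * A.mulVec w 0 =
      A.det * (v 0 * w 1 - v 1 * w 0) := by
  simp only [Matrix.mulVec, dotProduct, Fin.sum_univ_two, Matrix.det_fin_two]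
  ring

theorem exists_mulVec_ne_zero_of_ne_zero {A : Matrix (Fin 2) (Fin 2) ℝ} (hA : A ≠ 0) :
    ∃ v, A.mulVec v ≠ 0 := by
  by_contra! h
  exact hA (Matrix.ext_of_mulVec_single fun i => by rw [h, Matrix.zero_mulVec])

theorem sq_add_sq_ne_zero_of_ne_zero {v : Fin 2 → ℝ} (hv : v ≠ 0) : v 0 ^ 2 + v 1 ^ 2 ≠ 0 := by
  intro h
  apply hv
  ext i
  fin_cases i
  · simp only [Fin.zero_eta, Pi.zero_apply]; nlinarith [sq_nonneg (v 0), sq_nonneg (v 1)]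
  · simp only [Fin.mk_one, Pi.zero_apply]; nlinarith [sq_nonneg (v 0), sq_nonneg (v 1)]

end Plane

/-! ### Incidence of vectors and lines -/

namespace RP1

theorem mem_submodule_mk_iff {v : Fin 2 → ℝ} (hv : v ≠ 0) (w : Fin 2 → ℝ) :
    w ∈ (Projectivization.mk ℝ v hv : RP1).submodule ↔ w 0 * v 1 = w 1 * v 0 := by
  rw [Projectivization.submodule_mk, Submodule.mem_span_singleton]
  constructor
  · rintro ⟨t, rfl⟩
    simp only [Pi.smul_apply, smul_eq_mul]
    ring
  · intro h
    have hd := sq_add_sq_ne_zero_of_ne_zero hv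
    refine ⟨(w 0 * v 0 + w 1 * v 1) / (v 0 ^ 2 + v 1 ^ 2), ?_⟩
    ext i
    fin_cases i
    · simp only [Fin.zero_eta, Pi.smul_apply, smul_eq_mul]
      field_simp
      linear_combination - v 1 * h
    · simp only [Fin.mk_one, Pi.smul_apply, smul_eq_mul]
      field_simp
      linear_combination v 0 * h

theorem eq_mk_of_mem_submodule {w : Fin 2 → ℝ} (hw : w ≠ 0) {x : RP1} (h : w ∈ x.submodule) :
    x = Projectivization.mk ℝ w hw := by
  induction x using Projectivization.ind with | _ v hv =>
  rw [Projectivization.submodule_mk, Submodule.mem_span_singleton] at h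
  exact ((Projectivization.mk_eq_mk_iff' ℝ _ _ _ _).2 h).symm

theorem mem_submodule_mk_self {w : Fin 2 → ℝ} (hw : w ≠ 0) :
    w ∈ (Projectivization.mk ℝ w hw : RP1).submodule :=
  (mem_submodule_mk_iff hw w).2 (mul_comm _ _)

theorem eq_of_mem_submodule {w : Fin 2 → ℝ} (hw : w ≠ 0) {x y : RP1} (hx : w ∈ x.submodule)
    (hy : w ∈ y.submodule) : x = y :=
  (eq_mk_of_mem_submodule hw hx).trans (eq_mk_of_mem_submodule hw hy).symm

/-- The entries of the orthogonal projection onto a line. -/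
noncomputable def projEntries : RP1 → ℝ × ℝ × ℝ :=
  Projectivization.lift (fun v : { v : Fin 2 → ℝ // v ≠ 0 } =>
    (v.1 0 ^ 2 / (v.1 0 ^ 2 + v.1 1 ^ 2), v.1 0 * v.1 1 / (v.1 0 ^ 2 + v.1 1 ^ 2),
      v.1 1 ^ 2 / (v.1 0 ^ 2 + v.1 1 ^ 2))) (by
    intro a b t h
    have hb := sq_add_sq_ne_zero_of_ne_zero b.2
    have h0 : a.1 0 = t * b.1 0 := by simp [h]
    have h1 : a.1 1 = t * b.1 1 := by simp [h]
    have ht : t ≠ 0 := by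
      rintro rfl
      exact sq_add_sq_ne_zero_of_ne_zero a.2 (by simp [h0, h1])
    have hd : (t * b.1 0) ^ 2 + (t * b.1 1) ^ 2 = t ^ 2 * (b.1 0 ^ 2 + b.1 1 ^ 2) := by ring
    simp only [h0, h1, hd, Prod.mk.injEq]
    refine ⟨?_, ?_, ?_⟩ <;> field_simp)

theorem continuous_projEntries : Continuous projEntries := by
  refine isQuotientMap_mk.continuous_iff.2 ?_
  have h0 : Continuous fun v : { v : Fin 2 → ℝ // v ≠ 0 } => v.1 0 :=
    (continuous_apply 0).comp continuous_subtype_val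
  have h1 : Continuous fun v : { v : Fin 2 → ℝ // v ≠ 0 } => v.1 1 :=
    (continuous_apply 1).comp continuous_subtype_val
  have hd := (h0.pow 2).add (h1.pow 2)
  have pos := fun v : { v : Fin 2 → ℝ // v ≠ 0 } => sq_add_sq_ne_zero_of_ne_zero v.2
  exact ((h0.pow 2).div hd pos).prodMk
    (((h0.mul h1).div hd pos).prodMk ((h1.pow 2).div hd pos))

/-- The quadratic form on the right is the squared Euclidean distance from `w` to the line `x`. This
makes incidence the zero set of a function continuous in both variables. -/
theorem mem_submodule_iff_projEntries (x : RP1) (w : Fin 2 → ℝ) :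
    w ∈ x.submodule ↔ w 0 ^ 2 * (projEntries x).2.2 - 2 * (w 0 * w 1) * (projEntries x).2.1 +
      w 1 ^ 2 * (projEntries x).1 = 0 := by
  induction x using Projectivization.ind with | _ v hv =>
  have hd := sq_add_sq_ne_zero_of_ne_zero hv
  rw [mem_submodule_mk_iff]
  simp only [projEntries, Projectivization.lift_mk]
  have : w 0 ^ 2 * (v 1 ^ 2 / (v 0 ^ 2 + v 1 ^ 2)) -
      2 * (w 0 * w 1) * (v 0 * v 1 / (v 0 ^ 2 + v 1 ^ 2)) +
      w 1 ^ 2 * (v 0 ^ 2 / (v 0 ^ 2 + v 1 ^ 2)) =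
      (w 0 * v 1 - w 1 * v 0) ^ 2 / (v 0 ^ 2 + v 1 ^ 2) := by
    field_simp
    ring
  rw [this, div_eq_zero_iff, or_iff_left hd, sq_eq_zero_iff, sub_eq_zero]

/-- The zero vector lies on every line, so incidence survives limits even when the vectors
degenerate to `0`. -/
theorem isClosed_setOf_mem_submodule :
    IsClosed {q : (Fin 2 → ℝ) × RP1 | q.1 ∈ q.2.submodule} := by
  simp only [mem_submodule_iff_projEntries]
  have := continuous_projEntries
  exact isClosed_eq (by fun_prop) continuous_const

theorem injective_projEntries : Function.Injective projEntries := by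
  intro x y h
  refine eq_of_mem_submodule x.rep_nonzero (by rw [Projectivization.submodule_eq]; simp) ?_
  rw [mem_submodule_iff_projEntries, ← h, ← mem_submodule_iff_projEntries,
    Projectivization.submodule_eq]
  simp

instance instMetrizableSpace : TopologicalSpace.MetrizableSpace RP1 :=
  (continuous_projEntries.isClosedEmbedding injective_projEntries).isEmbedding.metrizableSpace

instance instNontrivial : Nontrivial RP1 := by
  have h₀ : ![(1 : ℝ), 0] ≠ 0 := fun h => one_ne_zero (congrFun h 0)
  have h₁ : ![(0 : ℝ), 1] ≠ 0 := fun h => one_ne_zero (congrFun h 1)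
  refine ⟨Projectivization.mk ℝ _ h₀, Projectivization.mk ℝ _ h₁, fun h => ?_⟩
  have hm := RP1.mem_submodule_mk_self h₀
  rw [h, mem_submodule_mk_iff] at hm
  simp at hm

theorem tendsto_of_mem_submodule {ι : Type*} {l : Filter ι} {w : ι → Fin 2 → ℝ}
    {w₀ : Fin 2 → ℝ} (h₀ : w₀ ≠ 0) (hw : Tendsto w l (𝓝 w₀)) {x : ι → RP1}
    (hx : ∀ᶠ i in l, w i ∈ (x i).submodule) :
    Tendsto x l (𝓝 (Projectivization.mk ℝ w₀ h₀)) := by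
  have hc := (isQuotientMap_mk.continuous.tendsto ⟨w₀, h₀⟩)
  classical
  -- The vectors `w i` are only eventually nonzero; the value `w₀` is a harmless default elsewhere.
  let w' : ι → { v : Fin 2 → ℝ // v ≠ 0 } := fun i => if h : w i ≠ 0 then ⟨w i, h⟩ else ⟨w₀, h₀⟩
  have hne : ∀ᶠ i in l, w i ≠ 0 := hw.eventually_ne h₀
  have hw' : Tendsto w' l (𝓝 ⟨w₀, h₀⟩) := by
    refine tendsto_subtype_rng.2 (hw.congr' ?_)
    filter_upwards [hne] with i hi
    simp [w', hi]
  refine (hc.comp hw').congr' ?_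
  filter_upwards [hne, hx] with i hi hxi
  have : w' i = ⟨w i, hi⟩ := by simp [w', hi]
  rw [Function.comp_apply, this]
  exact (eq_mk_of_mem_submodule hi hxi).symm

theorem mulVec_mem_submodule_smul (g : GL (Fin 2) ℝ) {x : RP1} {v : Fin 2 → ℝ}
    (h : v ∈ x.submodule) : g.1.mulVec v ∈ (g • x).submodule := by
  induction x using Projectivization.ind with | _ u hu =>
  rw [Projectivization.submodule_mk, Submodule.mem_span_singleton] at h
  obtain ⟨t, rfl⟩ := h
  rw [Projectivization.smul_mk, Projectivization.submodule_mk, Matrix.mulVec_smul]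
  exact Submodule.smul_mem _ _ (Submodule.mem_span_singleton_self _)

end RP1

/-! ### The enveloping semigroup -/

/-- A map which takes the value `z` at all points except perhaps `a`. -/
def IsConstantOff {X Y : Type*} (p : X → Y) (a : X) (z : Y) : Prop :=
  ∀ x, x ≠ a → p x = z

/-- Incidence determines `p` wherever `A.mulVec v ≠ 0`. For singular `A`, the image is a single
line, which is the constant value; on the kernel line the hypothesis says nothing, and `p` is
arbitrary there. -/
theorem continuous_or_isConstantOff_of_mulVec_mem {A : Matrix (Fin 2) (Fin 2) ℝ} (hA : A ≠ 0)
    {p : RP1 → RP1}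
    (hp : ∀ v (hv : v ≠ 0), A.mulVec v ∈ (p (Projectivization.mk ℝ v hv)).submodule) :
    Continuous p ∨ ∃ a z, IsConstantOff p a z := by
  by_cases hd : A.det = 0
  · right
    obtain ⟨u, hu, hAu⟩ := Matrix.exists_mulVec_eq_zero_iff.2 hd
    obtain ⟨w, hAw⟩ := exists_mulVec_ne_zero_of_ne_zero hA
    have hw : w ≠ 0 := by
      rintro rfl
      simp at hAw
    have hc : u 0 * w 1 - u 1 * w 0 ≠ 0 := by
      intro h
      have hmem : w ∈ (Projectivization.mk ℝ u hu : RP1).submodule :=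
        (RP1.mem_submodule_mk_iff hu w).2 (by linarith)
      rw [Projectivization.submodule_mk, Submodule.mem_span_singleton] at hmem
      obtain ⟨t, rfl⟩ := hmem
      exact hAw (by rw [Matrix.mulVec_smul, hAu, smul_zero])
    refine ⟨Projectivization.mk ℝ u hu, p (Projectivization.mk ℝ w hw), fun x hx => ?_⟩
    induction x using Projectivization.ind with | _ v hv =>
    have hcv : u 0 * v 1 - u 1 * v 0 ≠ 0 := by
      intro h
      refine hx (RP1.eq_of_mem_submodule hv (RP1.mem_submodule_mk_self hv) ?_)
      exact (RP1.mem_submodule_mk_iff hu v).2 (by linarith)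
    have key := cross_smul_mulVec_eq A u v w
    rw [hAu, smul_zero, zero_add] at key
    have hAv : A.mulVec v ≠ 0 := by
      intro h
      rw [h, smul_zero, eq_comm, smul_eq_zero] at key
      exact key.elim hcv hAw
    refine RP1.eq_of_mem_submodule hAv (hp v hv) ?_
    rw [← Submodule.smul_mem_iff _ hc, key]
    exact Submodule.smul_mem _ _ (hp w hw)
  · left
    let g : GL (Fin 2) ℝ := Matrix.GeneralLinearGroup.mkOfDetNeZero A hd
    have : p = fun x => g • x := by
      funext x
      induction x using Projectivization.ind with | _ v hv =>
      have hgv : A.mulVec v ≠ 0 := fun h => hd (Matrix.exists_mulVec_eq_zero_iff.1 ⟨v, hv, h⟩)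
      exact RP1.eq_of_mem_submodule hgv (hp v hv)
        (RP1.mulVec_mem_submodule_smul g (RP1.mem_submodule_mk_self hv))
    rw [this]
    exact continuous_const_smul g

theorem continuous_or_isConstantOff_of_mem_closure {p : RP1 → RP1}
    (hp : p ∈ closure (Set.range fun (g : GL (Fin 2) ℝ) (x : RP1) => g • x)) :
    Continuous p ∨ ∃ a z, IsConstantOff p a z := by
  let K : Set (Metric.sphere (0 : Fin 2 → Fin 2 → ℝ) 1 × (RP1 → RP1)) := {q | ∀ v (hv : v ≠ 0),
    (Matrix.of q.1.1).mulVec v ∈ (q.2 (Projectivization.mk ℝ v hv)).submodule}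
  have hK : IsClosed K := by
    simp only [K, Set.ofPred_forall]
    refine isClosed_iInter fun v => isClosed_iInter fun hv => ?_
    refine RP1.isClosed_setOf_mem_submodule.preimage
      (f := fun q : Metric.sphere (0 : Fin 2 → Fin 2 → ℝ) 1 × (RP1 → RP1) => ((Matrix.of q.1.1).mulVec v,
        q.2 (Projectivization.mk ℝ v hv))) ?_
    refine Continuous.prodMk ?_ ((continuous_apply _).comp continuous_snd)
    have h1 : Continuous fun q : Metric.sphere (0 : Fin 2 → Fin 2 → ℝ) 1 × (RP1 → RP1) => q.1.1 :=
      continuous_subtype_val.comp continuous_fst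
    exact Continuous.matrix_mulVec h1 continuous_const
  have hcl : IsClosed (Prod.snd '' K) := isClosedMap_snd_of_compactSpace K hK
  have hsub : (Set.range fun (g : GL (Fin 2) ℝ) (x : RP1) => g • x) ⊆ Prod.snd '' K := by
    rintro _ ⟨g, rfl⟩
    let A : Fin 2 → Fin 2 → ℝ := g.1
    have hA : A ≠ 0 := fun h => g.ne_zero h
    have hn : ‖A‖ ≠ 0 := norm_ne_zero_iff.2 hA
    refine ⟨(⟨‖A‖⁻¹ • A, by simp [norm_smul, hn]⟩, fun x => g • x), fun v hv => ?_, rfl⟩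
    change (‖A‖⁻¹ • g.1).mulVec v ∈ _
    rw [Matrix.smul_mulVec]
    exact Submodule.smul_mem _ _
      (RP1.mulVec_mem_submodule_smul g (RP1.mem_submodule_mk_self hv))
  obtain ⟨⟨A, q⟩, hAq, rfl⟩ := closure_minimal hsub hcl hp
  refine continuous_or_isConstantOff_of_mulVec_mem (A := Matrix.of A.1) ?_ hAq
  intro h
  have hA := A.2
  rw [show A.1 = 0 from h] at hA
  simp at hA

theorem Continuous.isBaireClassOne {X Y : Type*} [TopologicalSpace X]
    [TopologicalSpace.MetrizableSpace X] [TopologicalSpace Y] {p : X → Y} (hp : Continuous p) :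
    IsBaireClassOne p := by
  let := TopologicalSpace.metrizableSpaceMetric X
  intro U hU
  obtain ⟨F, hF, -, h, -⟩ := (hU.preimage hp).exists_iUnion_isClosed
  exact ⟨F, hF, h.symm⟩

/-- The preimage of an open set either contains all points but `a`, hence is open, or is contained
in `{a}`, hence is closed. -/
theorem IsConstantOff.isBaireClassOne {X Y : Type*} [TopologicalSpace X]
    [TopologicalSpace.MetrizableSpace X] [TopologicalSpace Y] {p : X → Y} {a : X} {z : Y}
    (hp : IsConstantOff p a z) : IsBaireClassOne p := by
  let := TopologicalSpace.metrizableSpaceMetric X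
  intro U hU
  by_cases hz : z ∈ U
  · have ho : IsOpen (p ⁻¹' U) := by
      rw [← isClosed_compl_iff]
      refine (Set.Subsingleton.anti (Set.subsingleton_singleton (a := a)) ?_).isClosed
      intro x hx
      by_contra hxa
      exact hx (by rw [Set.mem_preimage, hp x hxa]; exact hz)
    obtain ⟨F, hF, -, h, -⟩ := ho.exists_iUnion_isClosed
    exact ⟨F, hF, h.symm⟩
  · have hc : IsClosed (p ⁻¹' U) := by
      refine (Set.Subsingleton.anti (Set.subsingleton_singleton (a := a)) ?_).isClosed
      intro x hx
      by_contra hxa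
      rw [Set.mem_preimage, hp x hxa] at hx
      exact hz hx
    exact ⟨fun _ => p ⁻¹' U, fun _ => hc, (Set.iUnion_const _).symm⟩

theorem Continuous.isFragmented {X Y : Type*} [TopologicalSpace X] [UniformSpace Y] {p : X → Y}
    (hp : Continuous p) : IsFragmented ‹UniformSpace Y› p := by
  rintro A ⟨a, ha⟩ ε hε
  obtain ⟨δ, hδ, hsymm, hcomp⟩ := comp_symm_mem_uniformity_sets hε
  obtain ⟨O, hO, hOo, haO⟩ :=
    mem_nhds_iff.1 (hp.continuousAt (x := a) (UniformSpace.ball_mem_nhds (p a) hδ))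
  refine ⟨O, hOo, ⟨a, haO, ha⟩, fun x hx y hy => hcomp ?_⟩
  exact ⟨p a, UniformSpace.mem_ball_symmetry.1 (hO hx.1), hO hy.1⟩

theorem IsConstantOff.isFragmented {X Y : Type*} [TopologicalSpace X] [T1Space X]
    (ξ : UniformSpace Y) {p : X → Y} {a : X} {z : Y} (hp : IsConstantOff p a z) :
    IsFragmented ξ p := by
  intro A hA ε hε
  by_cases h : ∃ b ∈ A, b ≠ a
  · obtain ⟨b, hb, hba⟩ := h
    refine ⟨{a}ᶜ, isOpen_compl_singleton, ⟨b, hba, hb⟩, fun x hx y hy => ?_⟩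
    rw [hp x hx.1, hp y hy.1]
    exact refl_mem_uniformity hε
  · push Not at h
    refine ⟨Set.univ, isOpen_univ, by simpa using hA, fun x hx y hy => ?_⟩
    rw [h x hx.2, h y hy.2]
    exact refl_mem_uniformity hε

/-! ### Subgroups consisting of Möbius transformations -/

theorem mobius_apply (g : GL (Fin 2) ℝ) (x : RP1) : mobius g x = g • x := rfl

theorem mobius_mul (g h : GL (Fin 2) ℝ) : mobius (g * h) = mobius g * mobius h :=
  Homeomorph.ext fun x => mul_smul g h x

theorem mobius_one : mobius 1 = 1 :=
  Homeomorph.ext fun x => one_smul (GL (Fin 2) ℝ) x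

theorem mobius_inv (g : GL (Fin 2) ℝ) : mobius g⁻¹ = (mobius g)⁻¹ :=
  eq_inv_of_mul_eq_one_left (by rw [← mobius_mul, inv_mul_cancel, mobius_one])

theorem mobius_pow (g : GL (Fin 2) ℝ) (n : ℕ) : mobius (g ^ n) = mobius g ^ n := by
  induction n with
  | zero => rw [pow_zero, pow_zero, mobius_one]
  | succ n ih => rw [pow_succ, pow_succ, mobius_mul, ih]

theorem exists_eq_mobius_of_mem_closure {S : Set (RP1 ≃ₜ RP1)}
    (hS : ∀ f ∈ S, ∃ g, f = mobius g) {f : RP1 ≃ₜ RP1} (hf : f ∈ Subgroup.closure S) :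
    ∃ g, f = mobius g := by
  induction hf using Subgroup.closure_induction with
  | mem f hf => exact hS f hf
  | one => exact ⟨1, mobius_one.symm⟩
  | mul f f' _ _ h h' =>
    obtain ⟨g, rfl⟩ := h
    obtain ⟨g', rfl⟩ := h'
    exact ⟨g * g', (mobius_mul g g').symm⟩
  | inv f _ h =>
    obtain ⟨g, rfl⟩ := h
    exact ⟨g⁻¹, (mobius_inv g).symm⟩

theorem continuous_or_isConstantOff_of_mem_envelopingSemigroup {G : Subgroup (RP1 ≃ₜ RP1)}
    (hG : ∀ f ∈ G, ∃ g, f = mobius g) {p : RP1 → RP1} (hp : p ∈ envelopingSemigroup G RP1) :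
    Continuous p ∨ ∃ a z, IsConstantOff p a z := by
  refine continuous_or_isConstantOff_of_mem_closure (closure_mono ?_ hp)
  rintro _ ⟨f, rfl⟩
  obtain ⟨g, hg⟩ := hG f.1 f.2
  refine ⟨g, funext fun x => ?_⟩
  change g • x = f.1 x
  rw [hg, mobius_apply]

/-! ### Dynamics of parabolic transformations -/

/-- With `g = c + N` and `N ^ 2 = 0`, the power `g ^ n` is proportional to `1 + (n / c) N`. The term
in `N` dominates, so all lines tend to the image of `N`. -/
theorem Matrix.GeneralLinearGroup.IsParabolic.exists_tendsto_pow_smul {g : GL (Fin 2) ℝ}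
    (hg : g.IsParabolic) : ∃ a : RP1, ∀ x : RP1, Tendsto (fun n : ℕ => g ^ n • x) atTop (𝓝 a) := by
  obtain ⟨c, N, hgN, hN, hN2⟩ := Matrix.isParabolic_iff_exists.1 hg
  have hdet : N.det = 0 := by
    have := congrArg Matrix.det hN2
    rwa [Matrix.det_pow, Matrix.det_zero, sq_eq_zero_iff] at this
  have hNN : ∀ v, N.mulVec (N.mulVec v) = 0 := fun v => by
    rw [Matrix.mulVec_mulVec, ← sq, hN2, Matrix.zero_mulVec]
  have hgv : ∀ v, g.1.mulVec v = c • v + N.mulVec v := fun v => by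
    rw [hgN, Matrix.add_mulVec, Matrix.scalar_apply, ← Matrix.smul_one_eq_diagonal,
      Matrix.smul_mulVec, Matrix.one_mulVec]
  obtain ⟨e, he⟩ := exists_mulVec_ne_zero_of_ne_zero hN
  have hc : c ≠ 0 := by
    rintro rfl
    have h := hgv (N.mulVec e)
    rw [hNN, zero_smul, zero_add] at h
    exact g.det_ne_zero (Matrix.exists_mulVec_eq_zero_iff.1 ⟨_, he, h⟩)
  have hpow : ∀ (n : ℕ) (x : RP1) (v : Fin 2 → ℝ), v ∈ x.submodule →
      v + (n / c) • N.mulVec v ∈ (g ^ n • x).submodule := by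
    intro n x v hv
    induction n with
    | zero => simpa using hv
    | succ n ih =>
      have h := Submodule.smul_mem _ c⁻¹ (RP1.mulVec_mem_submodule_smul g ih)
      rw [smul_smul, ← pow_succ'] at h
      convert h using 1
      rw [hgv, Matrix.mulVec_add, Matrix.mulVec_smul, hNN, smul_zero, add_zero, smul_add,
        smul_smul, inv_mul_cancel₀ hc, one_smul, add_assoc, ← add_smul]
      congr 2
      push_cast
      field_simp
  refine ⟨Projectivization.mk ℝ _ he, fun x => ?_⟩
  induction x using Projectivization.ind with | _ v hv =>
  by_cases hNv : N.mulVec v = 0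
  -- The kernel of `N` is also its image, so this line is the limit itself and stays fixed.
  · have hva : Projectivization.mk ℝ v hv = (Projectivization.mk ℝ _ he : RP1) := by
      refine RP1.eq_of_mem_submodule hv (RP1.mem_submodule_mk_self hv) ?_
      rw [RP1.mem_submodule_mk_iff]
      have key := cross_smul_mulVec_eq N v e (N.mulVec e)
      rw [hNv, hNN, smul_zero, smul_zero, zero_add, smul_eq_zero, or_iff_left he] at key
      linarith
    rw [← hva]
    refine tendsto_const_nhds.congr fun n => ?_
    have := hpow n _ v (RP1.mem_submodule_mk_self hv)
    rw [hNv, smul_zero, add_zero] at this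
    exact (RP1.eq_mk_of_mem_submodule hv this).symm
  · have hva : Projectivization.mk ℝ _ hNv = (Projectivization.mk ℝ _ he : RP1) := by
      refine RP1.eq_of_mem_submodule hNv (RP1.mem_submodule_mk_self hNv) ?_
      rw [RP1.mem_submodule_mk_iff]
      have key := mulVec_cross_eq N v e
      rw [hdet, zero_mul] at key
      linarith
    rw [← hva]
    -- The vector from `hpow`, rescaled by `c / n` so that it has the nonzero limit `N.mulVec v`.
    refine RP1.tendsto_of_mem_submodule (w := fun n : ℕ => (c / n) • v + N.mulVec v) hNv ?_ ?_
    · have h := ((tendsto_const_div_atTop_nhds_zero_nat c).smul_const v).add_const (N.mulVec v)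
      rwa [zero_smul, zero_add] at h
    · filter_upwards [eventually_ne_atTop 0] with n hn
      have hn' : (n : ℝ) ≠ 0 := Nat.cast_ne_zero.2 hn
      have h := Submodule.smul_mem _ (c / n) (hpow n _ v (RP1.mem_submodule_mk_self hv))
      rwa [smul_add, smul_smul, div_mul_div_cancel₀ hn', div_self hc, one_smul] at h

/-! ### Dynamics of irrational rotations -/

/-- The line at angle `t` in the coordinates given by `P`. -/
noncomputable def lineAtAngle (P : GL (Fin 2) ℝ) (t : ℝ) : RP1 :=
  P • Projectivization.mk ℝ ![Real.cos t, Real.sin t] (by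
    intro h
    have h0 := congrFun h 0
    have h1 := congrFun h 1
    have := Real.sin_sq_add_cos_sq t
    simp at h0 h1
    simp [h0, h1] at this)

theorem continuous_lineAtAngle (P : GL (Fin 2) ℝ) : Continuous (lineAtAngle P) := by
  refine (continuous_const_smul P).comp (RP1.isQuotientMap_mk.continuous.comp
    (Continuous.subtype_mk (f := fun t : ℝ => ![Real.cos t, Real.sin t]) ?_ _))
  refine continuous_pi fun i => ?_
  fin_cases i
  · exact Real.continuous_cos
  · exact Real.continuous_sin

theorem surjective_lineAtAngle (P : GL (Fin 2) ℝ) : Function.Surjective (lineAtAngle P) := by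
  intro x
  obtain ⟨y, rfl⟩ := MulAction.surjective P x
  induction y using Projectivization.ind with | _ v hv =>
  refine ⟨Complex.arg ⟨v 0, v 1⟩, congrArg (P • ·) ?_⟩
  refine RP1.eq_of_mem_submodule hv ?_ (RP1.mem_submodule_mk_self hv)
  rw [RP1.mem_submodule_mk_iff]
  have h0 := Complex.norm_mul_cos_arg ⟨v 0, v 1⟩
  have h1 := Complex.norm_mul_sin_arg ⟨v 0, v 1⟩
  simp only at h0 h1
  simp only [Matrix.cons_val_zero, Matrix.cons_val_one]
  nth_rewrite 1 [← h0]
  nth_rewrite 4 [← h1]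
  ring

theorem lineAtAngle_add_pi (P : GL (Fin 2) ℝ) (t : ℝ) :
    lineAtAngle P (t + Real.pi) = lineAtAngle P t := by
  refine congrArg (P • ·) ((Projectivization.mk_eq_mk_iff' ℝ _ _ _ _).2 ⟨-1, ?_⟩)
  ext i
  fin_cases i <;> simp

theorem rotation_smul_lineAtAngle (P : GL (Fin 2) ℝ) (θ t : ℝ) :
    (P * rotationMatrix θ * P⁻¹) • lineAtAngle P t = lineAtAngle P (t + θ) := by
  rw [lineAtAngle, mul_smul, inv_smul_smul, mul_smul, Projectivization.smul_mk, lineAtAngle]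
  congr 2
  ext i
  change (rotationMatrix θ).1.mulVec _ i = _
  fin_cases i <;>
    simp [rotationMatrix, Matrix.planeConformalMatrix, Matrix.mulVec, dotProduct,
      Real.cos_add, Real.sin_add] <;> ring

theorem dense_orbit_of_irrational_rotation {P : GL (Fin 2) ℝ} {θ : ℝ}
    (hθ : Irrational (θ / Real.pi)) {G : Subgroup (RP1 ≃ₜ RP1)}
    (hG : mobius (P * rotationMatrix θ * P⁻¹) ∈ G) (x : RP1) :
    Dense (MulAction.orbit G x) := by
  obtain ⟨t, rfl⟩ := surjective_lineAtAngle P x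
  -- Adding `π` to an angle does not change the line, so it may join `θ` as a generator. Density on
  -- the circle then becomes density in `ℝ` of the subgroup generated by `θ` and `π`.
  have hH : ∀ s ∈ AddSubgroup.closure {θ, Real.pi}, ∀ t,
      lineAtAngle P (t + s) ∈ MulAction.orbit G (lineAtAngle P t) := by
    intro s hs
    induction hs using AddSubgroup.closure_induction with
    | mem s hs =>
      intro t
      rcases hs with rfl | rfl
      · rw [← rotation_smul_lineAtAngle]
        exact ⟨⟨_, hG⟩, rfl⟩
      · rw [lineAtAngle_add_pi]
        exact MulAction.mem_orbit_self _
    | zero =>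
      intro t
      rw [add_zero]
      exact MulAction.mem_orbit_self _
    | add r s _ _ hr hs =>
      intro t
      rw [← add_assoc, ← MulAction.orbit_eq_iff.2 (hr t)]
      exact hs _
    | neg s _ hs =>
      intro t
      rw [MulAction.mem_orbit_symm]
      simpa using hs (t + -s)
  have hd := ((surjective_lineAtAngle P).comp (Equiv.addLeft t).surjective).denseRange.dense_image
    ((continuous_lineAtAngle P).comp (continuous_const_add t))
    (dense_addSubgroupClosure_pair_iff.2 hθ)
  refine hd.mono ?_
  rintro _ ⟨s, hs, rfl⟩
  exact hH s hs t

/-! ### Probability measures -/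

section Measures

variable {G X : Type*} [Group G] [TopologicalSpace X] [MeasurableSpace X] [BorelSpace X]
  [MulAction G X] [ContinuousConstSMul G X]

theorem smul_diracProba (g : G) (a : X) : g • diracProba a = diracProba (g • a) := by
  apply Subtype.ext
  exact Measure.map_dirac' (continuous_const_smul g).measurable a

theorem tendsto_smul_diracProba {ι : Type*} {l : Filter ι} [l.IsCountablyGenerated] {g : ι → G}
    {a : X} (h : ∀ x, Tendsto (fun i => g i • x) l (𝓝 a)) (μ : ProbabilityMeasure X) :
    Tendsto (fun i => g i • μ) l (𝓝 (diracProba a)) := by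
  rw [ProbabilityMeasure.tendsto_iff_forall_integral_tendsto]
  intro f
  have hlim : ∫ x, f x ∂(diracProba a : Measure X) = ∫ _, f a ∂(μ : Measure X) := by
    rw [integral_const, probReal_univ, one_smul]
    exact integral_dirac' _ _ f.continuous.stronglyMeasurable
  have hmap : ∀ i, ∫ x, f x ∂((g i • μ : ProbabilityMeasure X) : Measure X) =
      ∫ x, f (g i • x) ∂(μ : Measure X) := fun i =>
    integral_map (continuous_const_smul (g i)).measurable.aemeasurable
      f.continuous.aestronglyMeasurable
  rw [hlim]
  simp only [hmap]
  refine tendsto_integral_filter_of_dominated_convergence (fun _ => ‖f‖) ?_ ?_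
    (integrable_const _) ?_
  · exact .of_forall fun i =>
      (f.continuous.comp (continuous_const_smul (g i))).aestronglyMeasurable
  · exact .of_forall fun i => .of_forall fun x => f.norm_coe_le_norm _
  · exact .of_forall fun x => (f.continuous.tendsto a).comp (h x)

theorem isStronglyProximal_of_tendsto {g : ℕ → G} {a : X}
    (h : ∀ x, Tendsto (fun n => g n • x) atTop (𝓝 a)) : IsStronglyProximal G X := by
  intro μ ν
  refine ⟨diracProba a, mem_closure_of_tendsto
    ((tendsto_smul_diracProba h μ).prodMk_nhds (tendsto_smul_diracProba h ν))
    (.of_forall fun n => ⟨g n, rfl⟩)⟩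

/-- A fixed measure equals its own limit under `g n`, the Dirac mass at `a`. Then `a` is a fixed
point whose closed one-point orbit would have to be dense. -/
theorem fixedPoints_probabilityMeasure_eq_empty [HasOuterApproxClosed X] [T1Space X]
    [Nontrivial X] [MulAction.IsMinimal G X] {g : ℕ → G} {a : X}
    (h : ∀ x, Tendsto (fun n => g n • x) atTop (𝓝 a)) :
    MulAction.fixedPoints G (ProbabilityMeasure X) = ∅ := by
  refine Set.eq_empty_of_forall_notMem fun μ hμ => ?_
  have hμa : μ = diracProba a :=
    tendsto_nhds_unique (tendsto_const_nhds.congr fun n => (hμ (g n)).symm)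
      (tendsto_smul_diracProba h μ)
  have hfix : ∀ c : G, c • a = a := fun c => by
    have := hμ c
    rw [hμa, smul_diracProba] at this
    exact injective_diracProba this
  have horb : MulAction.orbit G a = {a} := by
    ext x
    constructor
    · rintro ⟨c, rfl⟩
      exact hfix c
    · rintro rfl
      exact MulAction.mem_orbit_self _
  have hd := MulAction.dense_orbit G a
  rw [horb, dense_iff_closure_eq, closure_singleton] at hd
  obtain ⟨b, hb⟩ := exists_ne a
  exact hb (by rw [← Set.mem_singleton_iff, hd]; trivial)

theorem mem_fixedPoints_of_smulInvariantMeasure {μ : Measure X} [IsProbabilityMeasure μ]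
    [SMulInvariantMeasure G X μ] :
    (⟨μ, ‹_›⟩ : ProbabilityMeasure X) ∈ MulAction.fixedPoints G (ProbabilityMeasure X) := by
  intro g
  apply Subtype.ext
  change μ.map (g • ·) = μ
  ext s hs
  rw [Measure.map_apply (continuous_const_smul g).measurable hs]
  exact SMulInvariantMeasure.measure_preimage_smul g hs

end Measures

/-! ### The main theorem -/

theorem isParabolicMobius_upperRightHom :
    IsParabolicMobius (mobius (Matrix.GeneralLinearGroup.upperRightHom (1 : ℝ))) :=
  ⟨_, (Matrix.isParabolic_iff_of_upperTriangular (by simp)).2 (by simp), rfl⟩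

theorem isIrrationalRotationMobius_rotationMatrix :
    IsIrrationalRotationMobius
      (mobius (1 * rotationMatrix (√2 * Real.pi) * 1⁻¹)) :=
  ⟨1, _, by rw [mul_div_cancel_right₀ _ Real.pi_ne_zero]; exact irrational_sqrt_two, rfl⟩

theorem mainTheorem8 :
    (∃ T : RP1 ≃ₜ RP1, IsParabolicMobius T) ∧
    (∃ R : RP1 ≃ₜ RP1, IsIrrationalRotationMobius R) ∧
    ∀ T R : RP1 ≃ₜ RP1, IsParabolicMobius T → IsIrrationalRotationMobius R →
      ∀ G : Subgroup (RP1 ≃ₜ RP1), G = Subgroup.closure {T, R} →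
        CompactSpace RP1 ∧
        TopologicalSpace.MetrizableSpace RP1 ∧
        MulAction.IsMinimal G RP1 ∧
        (∀ p ∈ envelopingSemigroup G RP1, IsBaireClassOne p) ∧
        IsTame G RP1 ∧
        IsStronglyProximal G RP1 ∧
        MulAction.fixedPoints G (ProbabilityMeasure RP1) = ∅ ∧
        ¬ ∃ μ : Measure RP1, IsProbabilityMeasure μ ∧ SMulInvariantMeasure G RP1 μ := by
  refine ⟨⟨_, isParabolicMobius_upperRightHom⟩,
    ⟨_, isIrrationalRotationMobius_rotationMatrix⟩, ?_⟩
  rintro _ _ ⟨t, ht, rfl⟩ ⟨P, θ, hθ, rfl⟩ G hG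
  have hT : mobius t ∈ G := hG ▸ Subgroup.subset_closure (Set.mem_insert _ _)
  have hR : mobius (P * rotationMatrix θ * P⁻¹) ∈ G :=
    hG ▸ Subgroup.subset_closure (Set.mem_insert_of_mem _ rfl)
  have hmob : ∀ f ∈ G, ∃ g, f = mobius g := by
    intro f hf
    rw [hG] at hf
    refine exists_eq_mobius_of_mem_closure ?_ hf
    rintro _ (rfl | rfl)
    exacts [⟨_, rfl⟩, ⟨_, rfl⟩]
  have hmin : MulAction.IsMinimal G RP1 := ⟨dense_orbit_of_irrational_rotation hθ hR⟩
  obtain ⟨a, ha⟩ := ht.exists_tendsto_pow_smul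
  have hlim : ∀ x : RP1, Tendsto (fun n : ℕ => (⟨mobius t, hT⟩ : G) ^ n • x) atTop (𝓝 a) := by
    intro x
    refine (ha x).congr fun n => ?_
    change _ = (mobius t ^ n) x
    rw [← mobius_pow, mobius_apply]
  have hfix := fixedPoints_probabilityMeasure_eq_empty hlim
  refine ⟨inferInstance, inferInstance, hmin, fun p hp => ?_, fun p hp => ?_,
    isStronglyProximal_of_tendsto hlim, hfix, ?_⟩
  · rcases continuous_or_isConstantOff_of_mem_envelopingSemigroup hmob hp with h | ⟨a, z, h⟩
    exacts [h.isBaireClassOne, h.isBaireClassOne]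
  · rcases continuous_or_isConstantOff_of_mem_envelopingSemigroup hmob hp with h | ⟨a, z, h⟩
    -- This uniformity induces the given topology, so continuity of `p` applies to it directly.
    · let := uniformSpaceOfCompactR1 (γ := RP1)
      exact h.isFragmented
    · exact h.isFragmented _
  · rintro ⟨μ, _, _⟩
    have := mem_fixedPoints_of_smulInvariantMeasure (G := G) (μ := μ)
    rw [hfix] at this
    exact this
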